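/- Let $\mu$ be any Borel probability measure on $[0,1]$ (discrete, continuous, or neither). In the varying binary symmetric channel (VBSC) with state law $\mu$, crossover probabilities $P_1,P_2,\dots$ are drawn i.i.d. from $\mu$, independently of the transmitted message; given $P^n=p^n$ and the channel input $x^n\in\{0,1\}^n$, the outputs $Y_1,\dots,Y_n\in\{0,1\}$ are independent, with $Y_i\ne x_i$ with probability $p_i$ and $Y_i=x_i$ with probability $1-p_i$. Channel state information (CSI) is available only at the decoder: an encoder of block length $n$ with $M$ messages is a map $\{1,\dots,M\}\to\{0,1\}^n$. A decoder with non-causal CSI is a map $(y^n,p^n)\mapsto\hat m\in\{1,\dots,M\}$, measurable in $p^n$. A decoder with causal CSI has, at each time $k=0,\dots,n$, access only to $(y^k,p^k)$, on the basis of which (measurably in $p^k$) it either announces an estimate or waits; its first announcement is final, and making no announcement up to time $n$ counts as an error. For either type of decoder, a rate $R\ge 0$ is achievable if there is a sequence of codes (encoder and decoder), one for each block length $n$, with $\lceil 2^{nR}\rceil$ messages and with error probability, averaged over a uniformly distributed message, tending to $0$ as $n\to\infty$; the capacity is the supremum of the achievable rates. Let $P\sim\mu$, $H_2(p)=-p\log_2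 p-(1-p)\log_2(1-p)$ (with $0\log_2 0=0$), and $C_{BSC}(p)=1-H_2(p)$. Then the capacity of the VBSC with CSI only at the decoder, causal or non-causal, is in both cases $$C_{VBSC\text{-}D}=\mathbb{E}\left[C_{BSC}(P)\right]=\int_{[0,1]}\bigl(1-H_2(p)\bigr)\,d\mu(p).$$ -/

import Mathlib

open MeasureTheory

namespace VBSC

/-- The binary entropy function `H₂`, in bits (with `0 log 0 = 0`). -/
noncomputable def binaryEntropy (p : ℝ) : ℝ :=
  -p * Real.logb 2 p - (1 - p) * Real.logb 2 (1 - p)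

/-- `C_BSC(p) = 1 - H₂(p)`. -/
noncomputable def bscCapacity (p : ℝ) : ℝ := 1 - binaryEntropy p

/-- Transition probability from `x` to `y` of the BSC with crossover probability `p`. -/
def bscProb (p : unitInterval) (x y : Bool) : ℝ :=
  if y = x then 1 - (p : ℝ) else (p : ℝ)

/-- Probability of the output block `y`, given the input block `x` and the states `p`. -/
def blockProb {n : ℕ} (p : Fin n → unitInterval) (x y : Fin n → Bool) : ℝ :=
  ∏ i, bscProb (p i) (x i) (y i)

/-- An encoder without channel state information: block length `n`, messages `Fin M`. -/
abbrev Encoder (n M : ℕ) : Type := Fin M → Fin n → Bool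

/-- An estimation rule: the message estimate as a function of the outputs and the states.
The value `none` means that no estimate is produced. -/
abbrev Estimator (n M : ℕ) : Type :=
  (Fin n → Bool) → (Fin n → unitInterval) → Option (Fin M)

/-- Decoder with non-causal state information: an estimate computed from all outputs and all
states of the block. -/
structure NonCausalDecoder (n M : ℕ) where
  decode : (Fin n → Bool) → (Fin n → unitInterval) → Fin M
  measurable : ∀ y, Measurable (decode y)

/-- The estimation rule of a non-causal decoder. -/
def NonCausalDecoder.estimator {n M : ℕ} (d : NonCausalDecoder n M) : Estimator n M :=
  fun y p => some (d.decode y p)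

/-- Decoder with causal state information: at time `k = 0, …, n` it knows the first `k` outputs
and the first `k` states only, and from these it either announces an estimate or waits (`none`). -/
structure CausalDecoder (n M : ℕ) where
  decide : (k : Fin (n + 1)) → (Fin k → Bool) → (Fin k → unitInterval) → Option (Fin M)
  measurable : ∀ k y m, MeasurableSet {p | decide k y p = some m}

/-- The first `k` entries of a block of length `n`. -/
def pre {α : Type} {n : ℕ} (v : Fin n → α) (k : Fin (n + 1)) : Fin k → α :=
  fun i => v (Fin.castLE (Nat.le_of_lt_succ k.isLt) i)

/-- The estimation rule of a causal decoder: its first announcement is final. -/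
def CausalDecoder.estimator {n M : ℕ} (d : CausalDecoder n M) : Estimator n M :=
  fun y p => (List.finRange (n + 1)).findSome? fun k => d.decide k (pre y k) (pre p k)

/-- Probability that message `m` is not recovered. The states are i.i.d. with law `μ`,
independent of the message, and given the states and the input the output block has
law `blockProb`. -/
noncomputable def messageError (μ : Measure unitInterval) {n M : ℕ} (e : Encoder n M)
    (g : Estimator n M) (m : Fin M) : ℝ :=
  ∫ p, ∑ y, (if g y p = some m then 0 else blockProb p (e m) y) ∂(Measure.pi fun _ => μ)

/-- Average error probability, for a uniformly distributed message. -/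
noncomputable def averageError (μ : Measure unitInterval) {n M : ℕ} (e : Encoder n M)
    (g : Estimator n M) : ℝ :=
  (∑ m, messageError μ e g m) / M

/-- The number `⌈2 ^ (n R)⌉` of messages at rate `R` (bits per channel use), block length `n`. -/
noncomputable def numMessages (R : ℝ) (n : ℕ) : ℕ := ⌈(2 : ℝ) ^ ((n : ℝ) * R)⌉₊

/-- The rates achievable with non-causal state information at the decoder only: there are codes
of all block lengths whose error probabilities tend to zero. -/
def nonCausalRates (μ : Measure unitInterval) : Set ℝ :=
  {R | 0 ≤ R ∧ ∃ (e : ∀ n, Encoder n (numMessages R n))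
    (d : ∀ n, NonCausalDecoder n (numMessages R n)),
    Filter.Tendsto (fun n => averageError μ (e n) (d n).estimator) Filter.atTop (nhds 0)}

/-- The rates achievable with causal state information at the decoder only. -/
def causalRates (μ : Measure unitInterval) : Set ℝ :=
  {R | 0 ≤ R ∧ ∃ (e : ∀ n, Encoder n (numMessages R n))
    (d : ∀ n, CausalDecoder n (numMessages R n)),
    Filter.Tendsto (fun n => averageError μ (e n) (d n).estimator) Filter.atTop (nhds 0)}

/-- `C` is the capacity determined by a set of achievable rates: its least upper bound. -/
def IsCapacity (rates : Set ℝ) (C : ℝ) : Prop := IsLUB rates C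

end VBSC

namespace VBSC

/-! The block transition probability W concentrates, on the exponential scale, at exp(-nH), where H
is the mean entropy of the state in nats. Its moments of order 1 + s factor over the letters because
the states are i.i.d.; a second order expansion at s = 0, uniform in the crossover probability, then
gives Chernoff bounds on both sides for every μ (`upper_tail_le`, `lower_tail_le`).

Converse (`le_averageError`): for each output and state sequence only one message can be announced,
so correct decoding with W ≤ t contributes at most 2^n t / M. Any measurable estimator is allowed,
so causal decoders are covered.

Achievability (`exists_averageError_le`): codewords are picked greedily and the first one with W > t
is announced; symmetry of the channel bounds the average confusion probability by 1 / (2^n t). A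
causal decoder can imitate this by waiting until time n. -/

/-! ### Uniform second order expansion of powers -/

theorem exp_le_one_add_add_sq (u : ℝ) : Real.exp u ≤ 1 + u + u ^ 2 * (1 + Real.exp u) := by
  have h1 : Real.exp u * (1 - u) ≤ 1 := by
    have := mul_le_mul_of_nonneg_left (Real.one_sub_le_exp_neg u) (Real.exp_pos u).le
    rwa [← Real.exp_add, add_neg_cancel, Real.exp_zero] at this
  have h2 := Real.add_one_le_exp u
  have h3 := Real.exp_pos u
  rcases le_total 0 u with h | h
  · nlinarith [mul_nonneg h h]
  · nlinarith [mul_nonneg_of_nonpos_of_nonpos h h, mul_nonneg (sq_nonneg u) h3.le]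

theorem sqrt_mul_log_sq_le {q : ℝ} (h0 : 0 < q) (h1 : q ≤ 1) :
    q ^ (1 / 2 : ℝ) * Real.log q ^ 2 ≤ 16 := by
  have hr0 : 0 < q ^ (1 / 4 : ℝ) := Real.rpow_pos_of_pos h0 _
  have hr1 : q ^ (1 / 4 : ℝ) ≤ 1 := Real.rpow_le_one h0.le h1 (by norm_num)
  have key := Real.abs_log_mul_self_lt _ hr0 hr1
  rw [Real.log_rpow h0] at key
  have hsq : q ^ (1 / 2 : ℝ) = q ^ (1 / 4 : ℝ) * q ^ (1 / 4 : ℝ) := by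
    rw [← Real.rpow_add h0]; norm_num
  have := (sq_lt_one_iff_abs_lt_one _).2 key
  rw [hsq]
  nlinarith

/-- Second order expansion of `q ^ (1 + s)` around `s = 0`, uniformly in `q ∈ [0, 1]`. -/
theorem rpow_one_add_le {q s : ℝ} (h0 : 0 ≤ q) (h1 : q ≤ 1) (hs : |s| ≤ 1 / 2) :
    q ^ (1 + s) ≤ q + s * (q * Real.log q) + 32 * s ^ 2 := by
  obtain ⟨hs1, hs2⟩ := abs_le.1 hs
  rcases h0.eq_or_lt with rfl | h0
  · rw [Real.zero_rpow (by linarith)]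
    simp; positivity
  have hexp : q ^ s = Real.exp (s * Real.log q) := by
    rw [Real.rpow_def_of_pos h0, mul_comm]
  have hmul : q ^ (1 + s) = q * q ^ s := by rw [Real.rpow_add h0, Real.rpow_one]
  have e1 := mul_le_mul_of_nonneg_left (exp_le_one_add_add_sq (s * Real.log q)) h0.le
  rw [← hexp] at e1
  have hq1 : q ≤ q ^ (1 / 2 : ℝ) := by
    simpa using Real.rpow_le_rpow_of_exponent_ge h0 h1 (by norm_num : (1 / 2 : ℝ) ≤ 1)
  have hq2 : q * q ^ s ≤ q ^ (1 / 2 : ℝ) := by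
    rw [← hmul]
    exact Real.rpow_le_rpow_of_exponent_ge h0 h1 (by linarith)
  have e2 := sqrt_mul_log_sq_le h0 h1
  -- Both q and q ^ (1 + s) are at most √q, which absorbs the squared logarithm; hence 32 = 2 · 16.
  have e3 : (q + q * q ^ s) * (s * Real.log q) ^ 2 ≤
      (2 * q ^ (1 / 2 : ℝ)) * (s * Real.log q) ^ 2 :=
    mul_le_mul_of_nonneg_right (by linarith) (sq_nonneg _)
  have e4 := mul_le_mul_of_nonneg_right e2 (sq_nonneg s)
  rw [hmul]
  nlinarith

/-! ### Transition probabilities -/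

theorem bscProb_nonneg (p : unitInterval) (x y : Bool) : 0 ≤ bscProb p x y := by
  unfold bscProb
  split_ifs
  · linarith [p.2.2]
  · exact p.2.1

theorem bscProb_symm (p : unitInterval) (x y : Bool) : bscProb p x y = bscProb p y x := by
  simp [bscProb, eq_comm]

theorem continuous_bscProb (x y : Bool) : Continuous fun p => bscProb p x y := by
  unfold bscProb
  split_ifs <;> fun_prop

theorem sum_comp_bscProb (f : ℝ → ℝ) (p : unitInterval) (x : Bool) :
    ∑ y, f (bscProb p x y) = f p + f (1 - p) := by
  cases x <;> simp [bscProb, add_comm]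

variable {n : ℕ}

theorem blockProb_nonneg (p : Fin n → unitInterval) (x y : Fin n → Bool) :
    0 ≤ blockProb p x y :=
  Finset.prod_nonneg fun _ _ => bscProb_nonneg _ _ _

theorem blockProb_symm (p : Fin n → unitInterval) (x y : Fin n → Bool) :
    blockProb p x y = blockProb p y x :=
  Finset.prod_congr rfl fun _ _ => bscProb_symm _ _ _

theorem continuous_blockProb (x y : Fin n → Bool) : Continuous fun p => blockProb p x y :=
  continuous_finsetProd _ fun i _ => (continuous_bscProb _ _).comp (continuous_apply i)

theorem sum_prod_comp_bscProb (f : ℝ → ℝ) (p : Fin n → unitInterval) (x : Fin n → Bool) :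
    ∑ y : Fin n → Bool, ∏ i, f (bscProb (p i) (x i) (y i)) = ∏ i, (f (p i) + f (1 - p i)) := by
  rw [Finset.prod_congr rfl fun i _ => (sum_comp_bscProb f (p i) (x i)).symm,
    Finset.prod_univ_sum, Fintype.piFinset_univ]

theorem sum_blockProb (p : Fin n → unitInterval) (x : Fin n → Bool) :
    ∑ y, blockProb p x y = 1 := by
  have := sum_prod_comp_bscProb id p x
  simpa [blockProb] using this

theorem integrable_continuous {X : Type*} [TopologicalSpace X] [CompactSpace X]
    [MeasurableSpace X] [OpensMeasurableSpace X] (ν : Measure X) [IsFiniteMeasure ν]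
    {f : X → ℝ} (hf : Continuous f) : Integrable f ν := by
  obtain ⟨K, hK⟩ := isCompact_univ.exists_bound_of_continuousOn hf.continuousOn
  exact Integrable.of_bound hf.measurable.aestronglyMeasurable K
    (Filter.Eventually.of_forall fun x => hK x (Set.mem_univ x))

/-! ### Rate zero, and causal versus non-causal decoders -/

variable (μ : Measure unitInterval)

theorem averageError_nonneg {M : ℕ} (e : Encoder n M) (g : Estimator n M) :
    0 ≤ averageError μ e g := by
  refine div_nonneg (Finset.sum_nonneg fun m _ => integral_nonneg fun p =>
    Finset.sum_nonneg fun y _ => ?_) (Nat.cast_nonneg _)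
  split_ifs
  exacts [le_rfl, blockProb_nonneg _ _ _]

theorem averageError_eq_zero_of_subsingleton {M : ℕ} [Subsingleton (Fin M)] (e : Encoder n M)
    (d : NonCausalDecoder n M) : averageError μ e d.estimator = 0 := by
  have hdec (m : Fin M) (y p) : d.estimator y p = some m := congrArg some (Subsingleton.elim _ _)
  simp only [averageError, messageError, if_pos (hdec _ _ _), Finset.sum_const_zero,
    integral_zero, zero_div]

theorem numMessages_pos (R : ℝ) (n : ℕ) : 0 < numMessages R n :=
  Nat.ceil_pos.2 (Real.rpow_pos_of_pos two_pos _)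

/-- There is a single message at rate 0. This case is needed separately: if the capacity is 0, no
nonnegative rate lies strictly below it. -/
theorem zero_mem_nonCausalRates : (0 : ℝ) ∈ nonCausalRates μ := by
  have (n : ℕ) : Subsingleton (Fin (numMessages 0 n)) := by
    rw [show numMessages 0 n = 1 by simp [numMessages]]
    infer_instance
  refine ⟨le_rfl, fun n _ _ => false,
    fun n => ⟨fun _ _ => ⟨0, numMessages_pos 0 n⟩, fun _ => measurable_const⟩, ?_⟩
  simp_rw [averageError_eq_zero_of_subsingleton]
  exact tendsto_const_nhds

/-- The causal decoder that waits until the end of the block and then applies `d`. -/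
def NonCausalDecoder.toCausal {M : ℕ} (d : NonCausalDecoder n M) : CausalDecoder n M where
  decide k y p := if h : (k : ℕ) = n then
    some (d.decode (fun i => y (Fin.cast h.symm i)) (fun i => p (Fin.cast h.symm i))) else none
  measurable k y m := by
    by_cases h : (k : ℕ) = n
    · simp only [h, dite_true, Option.some.injEq]
      have hp : Measurable fun (p : Fin k → unitInterval) (i : Fin n) => p (Fin.cast h.symm i) :=
        measurable_pi_lambda _ fun i => measurable_pi_apply _
      exact ((d.measurable _).comp hp) (measurableSet_singleton m)
    · simp [h]

theorem NonCausalDecoder.estimator_toCausal {M : ℕ} (d : NonCausalDecoder n M) :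
    d.toCausal.estimator = d.estimator := by
  funext y p
  rw [CausalDecoder.estimator, List.finRange_succ_last, List.findSome?_append,
    List.findSome?_eq_none_iff.2]
  · simp [toCausal, estimator, pre]
  · simp only [List.mem_map]
    rintro _ ⟨i, -, rfl⟩
    simp [toCausal, i.2.ne]

theorem nonCausalRates_subset_causalRates : nonCausalRates μ ⊆ causalRates μ := by
  rintro R ⟨hR, e, d, h⟩
  refine ⟨hR, e, fun n => (d n).toCausal, ?_⟩
  simpa only [NonCausalDecoder.estimator_toCausal] using h

/-! ### Moments and tails of the block transition probability -/

variable [IsProbabilityMeasure μ]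

/-- Rényi-type moments of the block transition probability. -/
theorem integral_sum_rpow_blockProb_le (x : Fin n → Bool) {s : ℝ} (hs : |s| ≤ 1 / 2) :
    ∫ p, ∑ y, blockProb p x y ^ (1 + s) ∂(Measure.pi fun _ => μ) ≤
      Real.exp (n * (-s * ∫ p, Real.binEntropy (p : ℝ) ∂μ + 64 * s ^ 2)) := by
  have hs' : 0 ≤ 1 + s := by linarith [(abs_le.1 hs).1]
  have hfac : ∀ p : Fin n → unitInterval, ∑ y, blockProb p x y ^ (1 + s) =
      ∏ i, ((p i : ℝ) ^ (1 + s) + (1 - p i : ℝ) ^ (1 + s)) := fun p => by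
    rw [← sum_prod_comp_bscProb (fun q => q ^ (1 + s)) p x]
    exact Finset.sum_congr rfl fun y _ =>
      (Real.finsetProd_rpow _ _ (fun _ _ => bscProb_nonneg _ _ _) _).symm
  simp_rw [hfac]
  rw [integral_fintype_prod_eq_pow (ι := Fin n) (μ := μ)
    (f := fun p : unitInterval => (p : ℝ) ^ (1 + s) + (1 - p : ℝ) ^ (1 + s)), Fintype.card_fin,
    Real.exp_nat_mul]
  have hint : Integrable (fun p : unitInterval => Real.binEntropy (p : ℝ)) μ :=
    integrable_continuous μ (Real.binEntropy_continuous.comp continuous_subtype_val)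
  refine pow_le_pow_left₀ (integral_nonneg fun p => ?_) ?_ n
  · exact add_nonneg (Real.rpow_nonneg p.2.1 _) (Real.rpow_nonneg (by linarith [p.2.2]) _)
  -- The expansion is applied to p and to 1 - p; the two errors 32 s² add up to 64 s².
  have hle : ∀ p : unitInterval, (p : ℝ) ^ (1 + s) + (1 - p : ℝ) ^ (1 + s) ≤
      (1 + 64 * s ^ 2) + -s * Real.binEntropy p := fun p => by
    have h1 := rpow_one_add_le p.2.1 p.2.2 hs
    have h2 := rpow_one_add_le (q := 1 - p) (by linarith [p.2.2]) (by linarith [p.2.1]) hs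
    rw [Real.binEntropy_eq_negMulLog_add_negMulLog_one_sub, Real.negMulLog, Real.negMulLog]
    linarith
  calc _ ≤ ∫ p : unitInterval, (1 + 64 * s ^ 2) + -s * Real.binEntropy p ∂μ := by
        refine integral_mono (integrable_continuous μ ?_)
          ((integrable_const _).add (hint.const_mul _)) hle
        exact (continuous_subtype_val.rpow_const fun _ => Or.inr hs').add
          ((continuous_const.sub continuous_subtype_val).rpow_const fun _ => Or.inr hs')
    _ = -s * (∫ p : unitInterval, Real.binEntropy p ∂μ) + 64 * s ^ 2 + 1 := by
        rw [integral_add (integrable_const _) (hint.const_mul _), integral_const_mul]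
        simp; ring
    _ ≤ _ := Real.add_one_le_exp _

theorem integrable_ite_blockProb {P : (Fin n → unitInterval) → Prop} [DecidablePred P]
    (hP : MeasurableSet {p | P p}) (x y : Fin n → Bool) :
    Integrable (fun p => if P p then blockProb p x y else 0) (Measure.pi fun _ => μ) := by
  classical
  have := (integrable_continuous (Measure.pi fun _ => μ) (continuous_blockProb x y)).indicator hP
  exact this.congr (Filter.Eventually.of_forall fun p => by simp [Set.indicator_apply])

theorem integrable_sum_ite_lt (x : Fin n → Bool) (t : ℝ) :
    Integrable (fun p => ∑ y, if t < blockProb p x y then blockProb p x y else 0)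
      (Measure.pi fun _ => μ) :=
  integrable_finsetSum _ fun y _ => integrable_ite_blockProb μ
    (measurableSet_lt measurable_const (continuous_blockProb x y).measurable) x y

theorem integrable_sum_ite_le (x : Fin n → Bool) (t : ℝ) :
    Integrable (fun p => ∑ y, if blockProb p x y ≤ t then blockProb p x y else 0)
      (Measure.pi fun _ => μ) :=
  integrable_finsetSum _ fun y _ => integrable_ite_blockProb μ
    (measurableSet_le (continuous_blockProb x y).measurable measurable_const) x y

theorem integrable_sum_rpow (x : Fin n → Bool) {s : ℝ} (hs : |s| ≤ 1 / 2) :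
    Integrable (fun p => ∑ y, blockProb p x y ^ (1 + s)) (Measure.pi fun _ => μ) := by
  refine integrable_finsetSum _ fun y _ => integrable_continuous _ ?_
  exact (continuous_blockProb x y).rpow_const fun _ => Or.inr (by linarith [(abs_le.1 hs).1])

/-- The state-output pairs with transition probability far above its typical value are
exponentially unlikely. -/
theorem upper_tail_le (x : Fin n → Bool) {s δ : ℝ} (hs0 : 0 ≤ s) (hs : s ≤ 1 / 2) :
    ∫ p, ∑ y, (if Real.exp (-n * ((∫ p, Real.binEntropy (p : ℝ) ∂μ) - δ)) < blockProb p x y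
      then blockProb p x y else 0) ∂(Measure.pi fun _ => μ) ≤
      Real.exp (-n * (s * δ - 64 * s ^ 2)) := by
  set H := ∫ p, Real.binEntropy (p : ℝ) ∂μ with hH
  have hs' : |s| ≤ 1 / 2 := by rwa [abs_of_nonneg hs0]
  -- Markov's inequality: with t the threshold, (W / t) ^ s ≥ 1 on the event.
  calc _ ≤ ∫ p, Real.exp (s * (n * (H - δ))) * ∑ y, blockProb p x y ^ (1 + s)
        ∂(Measure.pi fun _ => μ) := by
        refine integral_mono (integrable_sum_ite_lt μ x _)
          ((integrable_sum_rpow μ x hs').const_mul _) fun p => ?_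
        simp only [Finset.mul_sum]
        refine Finset.sum_le_sum fun y _ => ?_
        split_ifs with h
        · have hpos := (Real.exp_pos _).trans h
          rw [Real.rpow_add hpos, Real.rpow_one]
          have h2 := Real.rpow_le_rpow (Real.exp_pos _).le h.le hs0
          rw [← Real.exp_mul] at h2
          have h3 := mul_le_mul_of_nonneg_left h2 (Real.exp_pos (s * (n * (H - δ)))).le
          rw [← Real.exp_add, show s * (n * (H - δ)) + -n * (H - δ) * s = 0 by ring,
            Real.exp_zero] at h3
          nlinarith
        · exact mul_nonneg (Real.exp_pos _).le (Real.rpow_nonneg (blockProb_nonneg _ _ _) _)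
    _ ≤ Real.exp (s * (n * (H - δ))) * Real.exp (n * (-s * H + 64 * s ^ 2)) := by
        rw [integral_const_mul]
        exact mul_le_mul_of_nonneg_left (integral_sum_rpow_blockProb_le μ x hs')
          (Real.exp_pos _).le
    _ = _ := by
        rw [← Real.exp_add]
        congr 1
        ring

/-- The state-output pairs with transition probability far below its typical value are
exponentially unlikely. -/
theorem lower_tail_le (x : Fin n → Bool) {s δ : ℝ} (hs0 : 0 ≤ s) (hs : s ≤ 1 / 2) :
    ∫ p, ∑ y, (if blockProb p x y ≤ Real.exp (-n * ((∫ p, Real.binEntropy (p : ℝ) ∂μ) + δ))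
      then blockProb p x y else 0) ∂(Measure.pi fun _ => μ) ≤
      Real.exp (-n * (s * δ - 64 * s ^ 2)) := by
  set H := ∫ p, Real.binEntropy (p : ℝ) ∂μ with hH
  have hs' : |-s| ≤ 1 / 2 := by rwa [abs_neg, abs_of_nonneg hs0]
  -- Now (t / W) ^ s ≥ 1 on the event where W > 0.
  calc _ ≤ ∫ p, Real.exp (-s * (n * (H + δ))) * ∑ y, blockProb p x y ^ (1 + -s)
        ∂(Measure.pi fun _ => μ) := by
        refine integral_mono (integrable_sum_ite_le μ x _)
          ((integrable_sum_rpow μ x hs').const_mul _) fun p => ?_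
        simp only [Finset.mul_sum]
        refine Finset.sum_le_sum fun y _ => ?_
        have hnn : 0 ≤ Real.exp (-s * (n * (H + δ))) * blockProb p x y ^ (1 + -s) :=
          mul_nonneg (Real.exp_pos _).le (Real.rpow_nonneg (blockProb_nonneg _ _ _) _)
        split_ifs with h
        · rcases (blockProb_nonneg p x y).eq_or_lt with h0 | hpos
          · rw [← h0] at hnn ⊢; exact hnn
          rw [Real.rpow_add hpos, Real.rpow_one]
          have h2 := Real.rpow_le_rpow_of_nonpos hpos h (neg_nonpos.2 hs0)
          rw [← Real.exp_mul] at h2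
          have h3 := mul_le_mul_of_nonneg_left h2 (Real.exp_pos (-s * (n * (H + δ)))).le
          rw [← Real.exp_add, show -s * (n * (H + δ)) + -n * (H + δ) * -s = 0 by ring,
            Real.exp_zero] at h3
          nlinarith
        · exact hnn
    _ ≤ Real.exp (-s * (n * (H + δ))) * Real.exp (n * (-(-s) * H + 64 * (-s) ^ 2)) := by
        rw [integral_const_mul]
        exact mul_le_mul_of_nonneg_left (integral_sum_rpow_blockProb_le μ x hs')
          (Real.exp_pos _).le
    _ = _ := by
        rw [← Real.exp_add]
        congr 1
        ring

/-! ### Converse bound at fixed block length -/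

theorem integrable_messageError {M : ℕ} (x : Fin n → Bool) {g : Estimator n M}
    (hg : ∀ y m, MeasurableSet {p | g y p = some m}) (m : Fin M) :
    Integrable (fun p => ∑ y, (if g y p = some m then 0 else blockProb p x y))
      (Measure.pi fun _ => μ) := by
  refine integrable_finsetSum _ fun y _ => ?_
  simpa only [ite_not] using
    integrable_ite_blockProb μ (P := fun p => ¬ g y p = some m) (hg y m).compl x y

/-- Threshold lower bound for the error probability of an arbitrary code. -/
theorem le_averageError {M : ℕ} (hM : 0 < M) (e : Encoder n M) {g : Estimator n M}
    (hg : ∀ y m, MeasurableSet {p | g y p = some m}) {t ε : ℝ} (ht : 0 ≤ t)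
    (hε : ∀ x : Fin n → Bool, ∫ p, ∑ y, (if t < blockProb p x y then blockProb p x y else 0)
      ∂(Measure.pi fun _ => μ) ≤ ε) :
    1 - ε - 2 ^ n * t / M ≤ averageError μ e g := by
  have hM' : (0 : ℝ) < M := Nat.cast_pos.2 hM
  have hpt : ∀ p : Fin n → unitInterval,
      (M : ℝ) - 2 ^ n * t - ∑ m, ∑ y, (if t < blockProb p (e m) y then blockProb p (e m) y else 0)
        ≤ ∑ m, ∑ y, (if g y p = some m then 0 else blockProb p (e m) y) := fun p => by
    have h1 : (M : ℝ) = ∑ m : Fin M, ∑ y, blockProb p (e m) y := by simp [sum_blockProb]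
    have h2 : ∑ m : Fin M, ∑ y : Fin n → Bool, (if g y p = some m then t else 0) ≤ 2 ^ n * t := by
      rw [Finset.sum_comm]
      calc _ ≤ ∑ y : Fin n → Bool, t := Finset.sum_le_sum fun y _ => by
            cases h : g y p <;> simp [ht]
        _ = _ := by simp
    -- Each output is decoded wrongly, or correctly with W ≤ t, or has W > t.
    have h3 : ∑ m : Fin M, ∑ y, blockProb p (e m) y ≤
        ∑ m, ∑ y, (if g y p = some m then 0 else blockProb p (e m) y) +
        ∑ m : Fin M, ∑ y : Fin n → Bool, (if g y p = some m then t else 0) +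
        ∑ m, ∑ y, (if t < blockProb p (e m) y then blockProb p (e m) y else 0) := by
      simp only [← Finset.sum_add_distrib]
      refine Finset.sum_le_sum fun m _ => Finset.sum_le_sum fun y _ => ?_
      have := blockProb_nonneg p (e m) y
      split_ifs <;> linarith
    linarith
  have hint := integrable_finsetSum Finset.univ fun m _ => integrable_sum_ite_lt μ (e m) t
  have h := integral_mono ((integrable_const ((M : ℝ) - 2 ^ n * t)).sub hint)
    (integrable_finsetSum Finset.univ fun m _ => integrable_messageError μ (e m) hg m) hpt
  simp only [Pi.sub_apply] at h
  rw [integral_sub (integrable_const _) hint,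
    integral_finsetSum _ fun m _ => integrable_sum_ite_lt μ (e m) t,
    integral_finsetSum _ fun m _ => integrable_messageError μ (e m) hg m] at h
  have hsum := Finset.sum_le_sum fun m (_ : m ∈ Finset.univ) => hε (e m)
  simp only [integral_const, probReal_univ, smul_eq_mul, one_mul, Finset.sum_const,
    Finset.card_univ, Fintype.card_fin, nsmul_eq_mul] at h hsum
  rw [averageError, le_div_iff₀ hM', sub_mul, div_mul_cancel₀ _ hM'.ne']
  simp only [messageError]
  linarith

/-! ### Achievability at fixed block length -/

/-- Greedy selection of a sequence with small pairwise interactions. -/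
theorem exists_greedy {X : Type*} [Fintype X] [Nonempty X] (A : X → X → ℝ) {K : ℝ}
    (hA : ∀ x', ∑ x, A x x' ≤ K * Fintype.card X) (M : ℕ) :
    ∃ e : Fin M → X, ∀ m, ∑ m', (if m' < m then A (e m) (e m') else 0) ≤ m * K := by
  induction M with
  | zero => exact ⟨Fin.elim0, fun m => m.elim0⟩
  | succ M ih =>
    obtain ⟨e, he⟩ := ih
    -- Averaged over all x, the interaction with the M chosen points is at most M K. Appending x
    -- leaves the earlier constraints intact, as these only look backwards.
    obtain ⟨x, -, hx⟩ : ∃ x ∈ Finset.univ, ∑ i, A x (e i) ≤ M * K := by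
      refine Finset.exists_le_of_sum_le Finset.univ_nonempty ?_
      rw [Finset.sum_comm]
      refine (Finset.sum_le_sum fun i _ => hA (e i)).trans_eq ?_
      simp; ring
    refine ⟨Fin.snoc (α := fun _ => X) e x, fun m => ?_⟩
    induction m using Fin.lastCases with
    | last => simpa [Fin.sum_univ_castSucc, Fin.castSucc_lt_last] using hx
    | cast m =>
      simpa [Fin.sum_univ_castSucc, (Fin.castSucc_lt_last m).not_gt] using he m

/-- The first index at which `b` holds, or `m₀` if there is none. -/
def firstTrue {M : ℕ} (m₀ : Fin M) (b : Fin M → Bool) : Fin M :=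
  if h : (Finset.univ.filter fun m => b m = true).Nonempty then
    (Finset.univ.filter fun m => b m = true).min' h else m₀

theorem firstTrue_eq {M : ℕ} (m₀ : Fin M) {b : Fin M → Bool} {m : Fin M} (hm : b m = true)
    (hlt : ∀ m' < m, b m' = false) : firstTrue m₀ b = m := by
  have hmem : m ∈ Finset.univ.filter fun m => b m = true := by simp [hm]
  rw [firstTrue, dif_pos ⟨m, hmem⟩]
  refine le_antisymm (Finset.min'_le _ _ hmem) (Finset.le_min' _ _ _ fun m' hm' => ?_)
  by_contra hcon
  simp [hlt m' (not_le.1 hcon)] at hm'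

/-- The decoder announcing the first message whose codeword has transition probability
above `t`. -/
noncomputable def thresholdDecoder {M : ℕ} (m₀ : Fin M) (e : Encoder n M) (t : ℝ) :
    NonCausalDecoder n M where
  decode y p := firstTrue m₀ fun m => decide (t < blockProb p (e m) y)
  measurable y := by
    refine (Measurable.of_discrete (f := firstTrue m₀)).comp (measurable_pi_lambda _ fun m => ?_)
    refine measurable_to_bool ?_
    simpa [Set.preimage] using
      measurableSet_lt measurable_const (continuous_blockProb (e m) y).measurable

/-- Threshold upper bound for the error probability of a suitable code. -/
theorem exists_averageError_le {M : ℕ} (hM : 0 < M) {t ε : ℝ} (ht : 0 < t)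
    (hε : ∀ x : Fin n → Bool, ∫ p, ∑ y, (if blockProb p x y ≤ t then blockProb p x y else 0)
      ∂(Measure.pi fun _ => μ) ≤ ε) :
    ∃ (e : Encoder n M) (d : NonCausalDecoder n M),
      averageError μ e d.estimator ≤ ε + M / (2 ^ n * t) := by
  have hM' : (0 : ℝ) < M := Nat.cast_pos.2 hM
  have hint : ∀ x x' : Fin n → Bool,
      Integrable (fun p => ∑ y, if t < blockProb p x' y then blockProb p x y else 0)
        (Measure.pi fun _ => μ) := fun x x' =>
    integrable_finsetSum _ fun y _ => integrable_ite_blockProb μ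
      (measurableSet_lt measurable_const (continuous_blockProb x' y).measurable) x y
  -- The interaction of x with x' is the probability that x, when sent, produces an output clearing
  -- the threshold of x'.
  obtain ⟨e, he⟩ := exists_greedy (X := Fin n → Bool)
    (fun x x' => ∫ p, ∑ y, (if t < blockProb p x' y then blockProb p x y else 0)
      ∂(Measure.pi fun _ => μ)) (K := 1 / (2 ^ n * t)) (fun x' => by
        rw [← integral_finsetSum _ fun x _ => hint x x']
        have hpt : ∀ p : Fin n → unitInterval,
            ∑ x, ∑ y, (if t < blockProb p x' y then blockProb p x y else 0) ≤ 1 / t := fun p => by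
          rw [Finset.sum_comm, le_div_iff₀ ht, Finset.sum_mul, ← sum_blockProb p x']
          refine Finset.sum_le_sum fun y _ => ?_
          split_ifs with h
          -- By symmetry the inputs x also carry total mass one for fixed y, while t < W for the
          -- codeword x'.
          · have : ∑ x, blockProb p x y = 1 := by
              simp_rw [blockProb_symm p _ y, sum_blockProb]
            rw [this, one_mul]
            exact h.le
          · simpa using blockProb_nonneg p x' y
        refine (integral_mono (integrable_finsetSum _ fun x _ => hint x x')
          (integrable_const _) hpt).trans_eq ?_
        simp) M
  refine ⟨e, thresholdDecoder ⟨0, hM⟩ e t, ?_⟩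
  have hmsg : ∀ m, messageError μ e (thresholdDecoder ⟨0, hM⟩ e t).estimator m ≤
      ε + M / (2 ^ n * t) := fun m => by
    have hi : ∀ m', Integrable (fun p => if m' < m then
        ∑ y, (if t < blockProb p (e m') y then blockProb p (e m) y else 0) else 0)
        (Measure.pi fun _ => μ) := fun m' => by
      split_ifs
      exacts [hint _ _, integrable_zero _ _ _]
    have h2 : ∑ m', ∫ p, (if m' < m then
        ∑ y, (if t < blockProb p (e m') y then blockProb p (e m) y else 0) else 0)
        ∂(Measure.pi fun _ => μ) ≤ M / (2 ^ n * t) := by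
      refine le_trans ((Finset.sum_congr rfl fun m' _ => ?_).trans_le (he m)) ?_
      · split_ifs <;> simp
      · rw [mul_one_div]
        gcongr
        exact m.2.le
    refine le_trans ?_ (add_le_add (hε (e m)) h2)
    rw [← integral_finsetSum _ fun m' _ => hi m', ← integral_add (integrable_sum_ite_le μ _ _)
      (integrable_finsetSum _ fun m' _ => hi m')]
    refine integral_mono (integrable_messageError μ (e m) (fun y m' => ?_) m)
      ((integrable_sum_ite_le μ _ _).add (integrable_finsetSum _ fun m' _ => hi m')) fun p => ?_
    · simpa [NonCausalDecoder.estimator, Set.preimage] using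
        (thresholdDecoder ⟨0, hM⟩ e t).measurable y (measurableSet_singleton m')
    · have hsw : ∑ m', (if m' < m then
          ∑ y, (if t < blockProb p (e m') y then blockProb p (e m) y else 0) else 0) =
          ∑ y, ∑ m', (if m' < m ∧ t < blockProb p (e m') y then blockProb p (e m) y else 0) := by
        rw [Finset.sum_comm]
        refine Finset.sum_congr rfl fun m' _ => ?_
        by_cases h : m' < m <;> simp [h]
      simp only [hsw, ← Finset.sum_add_distrib]
      refine Finset.sum_le_sum fun y _ => ?_
      have hnn := blockProb_nonneg p (e m) y
      have hterm : ∀ m' ∈ Finset.univ, (0 : ℝ) ≤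
          if m' < m ∧ t < blockProb p (e m') y then blockProb p (e m) y else 0 := fun m' _ => by
        split_ifs
        exacts [hnn, le_rfl]
      -- An error requires the sent codeword to miss the threshold or an earlier one to clear it;
      -- later codewords are harmless.
      by_cases h1 : blockProb p (e m) y ≤ t
      · rw [if_pos h1]
        have := Finset.sum_nonneg hterm
        split_ifs <;> linarith
      rw [if_neg h1, zero_add]
      by_cases h2 : ∃ m' < m, t < blockProb p (e m') y
      · obtain ⟨m', hlt, hm'⟩ := h2
        refine le_trans ?_ (Finset.single_le_sum hterm (Finset.mem_univ m'))
        simp only [hlt, hm', and_self, if_true]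
        split_ifs
        exacts [hnn, le_rfl]
      · push Not at h2
        rw [if_pos]
        · exact Finset.sum_nonneg hterm
        · exact congrArg some (firstTrue_eq _ (by simpa using h1) fun m' hm' => by
            simpa using h2 m' hm')
  rw [averageError, div_le_iff₀ hM']
  refine (Finset.sum_le_sum fun m _ => hmsg m).trans_eq ?_
  simp; ring

/-! ### Measurability of the estimators -/

theorem measurableSet_findSome? {Ω α β : Type*} [MeasurableSpace Ω] [Countable β] (l : List α)
    (f : α → Ω → Option β) (hf : ∀ a b, MeasurableSet {ω | f a ω = some b}) (b : β) :
    MeasurableSet {ω | l.findSome? (fun a => f a ω) = some b} := by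
  induction l with
  | nil => simp
  | cons a l ih =>
    have : {ω | (a :: l).findSome? (fun a => f a ω) = some b} = {ω | f a ω = some b} ∪
        ((⋃ b', {ω | f a ω = some b'})ᶜ ∩ {ω | l.findSome? (fun a => f a ω) = some b}) := by
      ext ω
      cases h : f a ω <;> simp [List.findSome?_cons, h]
    rw [this]
    exact (hf a b).union ((MeasurableSet.iUnion (hf a)).compl.inter ih)

theorem CausalDecoder.measurableSet_estimator {M : ℕ} (d : CausalDecoder n M)
    (y : Fin n → Bool) (m : Fin M) : MeasurableSet {p | d.estimator y p = some m} :=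
  measurableSet_findSome? _ (fun k p => d.decide k (pre y k) (pre p k)) (fun k m' =>
    (measurable_pi_lambda (fun p => pre p k) fun _ => measurable_pi_apply _)
      (d.measurable k (pre y k) m')) m

theorem NonCausalDecoder.measurableSet_estimator {M : ℕ} (d : NonCausalDecoder n M)
    (y : Fin n → Bool) (m : Fin M) : MeasurableSet {p | d.estimator y p = some m} := by
  simpa [estimator, Set.preimage] using d.measurable y (measurableSet_singleton m)

/-! ### Asymptotics and the capacity -/

theorem two_rpow_eq_exp (R : ℝ) (n : ℕ) :
    (2 : ℝ) ^ ((n : ℝ) * R) = Real.exp (n * (R * Real.log 2)) := by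
  rw [Real.rpow_def_of_pos two_pos]
  congr 1
  ring

theorem exp_le_numMessages (R : ℝ) (n : ℕ) :
    Real.exp (n * (R * Real.log 2)) ≤ numMessages R n := by
  rw [← two_rpow_eq_exp]
  exact Nat.le_ceil _

theorem numMessages_le {R : ℝ} (hR : 0 ≤ R) (n : ℕ) :
    (numMessages R n : ℝ) ≤ 2 * Real.exp (n * (R * Real.log 2)) := by
  have h1 : (1 : ℝ) ≤ Real.exp (n * (R * Real.log 2)) :=
    Real.one_le_exp (by positivity)
  have h2 := (Nat.ceil_lt_add_one (Real.rpow_pos_of_pos two_pos ((n : ℝ) * R)).le).le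
  rw [two_rpow_eq_exp] at h2
  rw [numMessages, two_rpow_eq_exp]
  linarith

theorem binaryEntropy_eq (p : ℝ) : binaryEntropy p = Real.binEntropy p / Real.log 2 := by
  rw [binaryEntropy, Real.binEntropy_eq_negMulLog_add_negMulLog_one_sub, Real.negMulLog,
    Real.negMulLog, Real.logb, Real.logb]
  ring

theorem integral_bscCapacity :
    ∫ p : unitInterval, bscCapacity (p : ℝ) ∂μ =
      1 - (∫ p : unitInterval, Real.binEntropy (p : ℝ) ∂μ) / Real.log 2 := by
  have hint : Integrable (fun p : unitInterval => Real.binEntropy (p : ℝ)) μ :=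
    integrable_continuous μ (Real.binEntropy_continuous.comp continuous_subtype_val)
  simp_rw [bscCapacity, binaryEntropy_eq]
  rw [integral_sub (integrable_const _) (hint.div_const _), integral_div]
  simp

theorem exists_exponent {δ : ℝ} (hδ : 0 < δ) :
    ∃ s : ℝ, 0 ≤ s ∧ s ≤ 1 / 2 ∧ 0 < s * δ - 64 * s ^ 2 := by
  have h1 : min δ 1 ≤ δ := min_le_left _ _
  have h2 : min δ 1 ≤ 1 := min_le_right _ _
  have h3 : 0 < min δ 1 := lt_min hδ one_pos
  refine ⟨min δ 1 / 128, by positivity, by linarith, ?_⟩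
  nlinarith

theorem tendsto_exp_neg_nat_mul {c : ℝ} (hc : 0 < c) :
    Filter.Tendsto (fun n : ℕ => Real.exp (-n * c)) Filter.atTop (nhds 0) := by
  simp_rw [neg_mul]
  exact Real.tendsto_exp_neg_atTop_nhds_zero.comp
    (tendsto_natCast_atTop_atTop.atTop_mul_const hc)

theorem two_pow_eq_exp (n : ℕ) : (2 : ℝ) ^ n = Real.exp (n * Real.log 2) := by
  rw [Real.exp_nat_mul, Real.exp_log two_pos]

/-- No code with a rate above `E[C_BSC(P)]` has vanishing error probability. -/
theorem rate_le_of_tendsto {R : ℝ} (e : ∀ n, Encoder n (numMessages R n))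
    (g : ∀ n, Estimator n (numMessages R n))
    (hg : ∀ n y m, MeasurableSet {p | g n y p = some m})
    (h : Filter.Tendsto (fun n => averageError μ (e n) (g n)) Filter.atTop (nhds 0)) :
    R ≤ ∫ p : unitInterval, bscCapacity (p : ℝ) ∂μ := by
  rw [integral_bscCapacity]
  set H := ∫ p : unitInterval, Real.binEntropy (p : ℝ) ∂μ with hH
  by_contra! hlt
  have hlog := Real.log_pos one_lt_two
  -- Half of the rate gap, in nats, goes to the tail margin; the other half leaves 2^n t / M ≤
  -- exp(-nδ).
  have hδ : 0 < (R * Real.log 2 - Real.log 2 + H) / 2 := by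
    have := mul_lt_mul_of_pos_right hlt hlog
    rw [sub_mul, div_mul_cancel₀ _ hlog.ne'] at this
    linarith
  set δ := (R * Real.log 2 - Real.log 2 + H) / 2 with hδdef
  obtain ⟨s, hs0, hs1, hs⟩ := exists_exponent hδ
  have hle : ∀ n : ℕ, 1 - Real.exp (-n * (s * δ - 64 * s ^ 2)) - Real.exp (-n * δ) ≤
      averageError μ (e n) (g n) := fun n => by
    refine le_trans ?_ (le_averageError μ (numMessages_pos R n) (e n) (hg n)
      (Real.exp_pos (-n * (H - δ))).le fun x => upper_tail_le μ x hs0 hs1)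
    refine sub_le_sub_left ?_ _
    rw [div_le_iff₀ (Nat.cast_pos.2 (numMessages_pos R n))]
    refine le_trans (le_of_eq ?_)
      (mul_le_mul_of_nonneg_left (exp_le_numMessages R n) (Real.exp_pos _).le)
    rw [two_pow_eq_exp, ← Real.exp_add, ← Real.exp_add]
    congr 1
    rw [hδdef]
    ring
  have hlim := ((tendsto_const_nhds (x := (1 : ℝ))).sub (tendsto_exp_neg_nat_mul hs)).sub
    (tendsto_exp_neg_nat_mul hδ)
  have := le_of_tendsto_of_tendsto' hlim h hle
  norm_num at this

/-- Every rate below `E[C_BSC(P)]` is achievable with non-causal state information. -/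
theorem mem_nonCausalRates {R : ℝ} (hR : 0 ≤ R)
    (hlt : R < ∫ p : unitInterval, bscCapacity (p : ℝ) ∂μ) : R ∈ nonCausalRates μ := by
  rw [integral_bscCapacity] at hlt
  set H := ∫ p : unitInterval, Real.binEntropy (p : ℝ) ∂μ with hH
  have hlog := Real.log_pos one_lt_two
  have hδ : 0 < (Real.log 2 - H - R * Real.log 2) / 2 := by
    have := mul_lt_mul_of_pos_right hlt hlog
    rw [sub_mul, div_mul_cancel₀ _ hlog.ne'] at this
    linarith
  set δ := (Real.log 2 - H - R * Real.log 2) / 2 with hδdef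
  obtain ⟨s, hs0, hs1, hs⟩ := exists_exponent hδ
  choose e d hed using fun n : ℕ => exists_averageError_le μ (numMessages_pos R n)
    (Real.exp_pos (-n * (H + δ))) fun x => lower_tail_le μ x hs0 hs1
  refine ⟨hR, e, d, ?_⟩
  have hlim := (tendsto_exp_neg_nat_mul hs).add ((tendsto_exp_neg_nat_mul hδ).const_mul 2)
  rw [mul_zero, add_zero] at hlim
  refine squeeze_zero (fun n => averageError_nonneg μ _ _) (fun n => (hed n).trans ?_) hlim
  -- The same splitting of the gap gives M / (2^n t) ≤ 2 exp(-nδ), the factor 2 coming from the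
  -- ceiling in the number of messages.
  refine add_le_add_right ?_ _
  rw [div_le_iff₀ (by positivity)]
  refine (numMessages_le hR n).trans_eq ?_
  rw [two_pow_eq_exp, mul_assoc, ← Real.exp_add, ← Real.exp_add]
  congr 2
  rw [hδdef]
  ring

theorem isLUB_of_Ico_subset {S : Set ℝ} {C : ℝ} (h0 : 0 ∈ S)
    (hS : ∀ R, 0 ≤ R → R < C → R ∈ S) (hub : ∀ R ∈ S, R ≤ C) : IsLUB S C := by
  refine ⟨hub, fun b hb => ?_⟩
  by_contra! hlt
  have hb0 : 0 ≤ b := hb h0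
  have := hb (hS ((b + C) / 2) (by linarith) (by linarith))
  linarith

end VBSC

theorem mainTheorem3 (μ : MeasureTheory.Measure unitInterval)
    [MeasureTheory.IsProbabilityMeasure μ] :
    VBSC.IsCapacity (VBSC.nonCausalRates μ) (∫ p, VBSC.bscCapacity (p : ℝ) ∂μ) ∧
      VBSC.IsCapacity (VBSC.causalRates μ) (∫ p, VBSC.bscCapacity (p : ℝ) ∂μ) := by
  have hsub := VBSC.nonCausalRates_subset_causalRates μ
  have h0 := VBSC.zero_mem_nonCausalRates μ
  refine ⟨VBSC.isLUB_of_Ico_subset h0 (fun R => VBSC.mem_nonCausalRates μ) ?_,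
    VBSC.isLUB_of_Ico_subset (hsub h0)
      (fun R hR hlt => hsub (VBSC.mem_nonCausalRates μ hR hlt)) ?_⟩
  · rintro R ⟨-, e, d, h⟩
    exact VBSC.rate_le_of_tendsto μ e _ (fun n => (d n).measurableSet_estimator) h
  · rintro R ⟨-, e, d, h⟩
    exact VBSC.rate_le_of_tendsto μ e _ (fun n => (d n).measurableSet_estimator) h
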